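/- There is a set-valued map $C$ that assigns to each $s\in[0,1]$ a nonempty set $C(s)\subseteq[0,1]$ such that (i) the graph $A=\{(s,x)\in[0,1]^2 : x\in C(s)\}$ is a Borel set, but (ii) there is no Borel measurable choice function, that is, no Borel measurable $\psi:[0,1]\to[0,1]$ with $\psi(s)\in C(s)$ for all $s\in[0,1]$, and nevertheless there are a probability space $(\Omega,\mathcal F,P)$, i.i.d. random variables $(U_k)_{k=0}^\infty$ on it that are uniformly distributed on $[0,1]$, and a bijection $b:[0,1]\to A$, Borel measurable with Borel measurable inverse, such that the random vectors $(S_k,X_k)=b(U_k)$, $k\in\{1,2,3,\dots\}$, have the following properties. (iii) $(S_k,X_k)_{k=1}^\infty$ are i.i.d., and $X_k(\omega)\in C(S_k(\omega))$ for all $k\geq 1$ and all $\omega\in\Omega$. (iv) For every $k\geq 1$ there are a Borel measurable function $h_k:[0,1]^2\to[0,1]$ and a random variable $W_k:\Omega\to[0,1]$ that is uniformly distributed on $[0,1]$, independent of $S_k$, and $\sigma(S_k,X_k,U_0)$-measurable, such that $X_k(\omega)=h_k(S_k(\omega),W_k(\omega))$ for all $\omega\in\Omega$. Moreover, for every probability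 space $(\Omega',\mathcal F',P')$ and every random element $(S,W):\Omega'\to[0,1]^2$ with the same distribution as $(S_k,W_k)$, one has $P'[h_k(S,W)\in C(S)]=1$. -/

import Mathlib

open MeasureTheory ProbabilityTheory unitInterval

universe u

section Systems

/-- The graph `{(s, x) : x ∈ C s}` of a set-valued map `C`. -/
def choiceGraph {ΩS ΩX : Type*} (C : ΩS → Set ΩX) : Set (ΩS × ΩX) :=
  {p | p.2 ∈ C p.1}

/-- There is a (deterministic) measurable choice function `ψ` with `ψ s ∈ C s` for all `s`. -/
def HasMeasurableChoice {ΩS ΩX : Type*} [MeasurableSpace ΩS] [MeasurableSpace ΩX]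
    (C : ΩS → Set ΩX) : Prop :=
  ∃ ψ : ΩS → ΩX, Measurable ψ ∧ ∀ s, ψ s ∈ C s

/-- The graph of `C` is measurable for the product sigma algebra. -/
def HasMeasurableGraph {ΩS ΩX : Type*} [MeasurableSpace ΩS] [MeasurableSpace ΩX]
    (C : ΩS → Set ΩX) : Prop :=
  MeasurableSet (choiceGraph C)

end Systems

section RandomElements

/-- `(Y i)` is a family of independent, identically distributed random elements of `E`. -/
def IsIID {ι Ω E : Type*} [MeasurableSpace Ω] [MeasurableSpace E]
    (Y : ι → Ω → E) (P : Measure Ω) : Prop :=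
  (∀ i, Measurable (Y i)) ∧ iIndepFun Y P ∧ ∀ i j, IdentDistrib (Y i) (Y j) P P

/-- `V` is a random variable with values in `[0,1]` that is uniformly distributed on `[0,1]`. -/
def IsUniform {Ω : Type*} [MeasurableSpace Ω] (V : Ω → I) (P : Measure Ω) : Prop :=
  Measurable V ∧ P.map V = volume

end RandomElements

/-!
The set-valued map `C` comes from a diagonal argument in the Cantor space `ℕ → Bool`. Borel sets are
analytic, so every Borel set is the set of points at which a tree, coded by a point of the space,
has an infinite branch (`MeasurableSet.exists_code`). Let `x` code two such trees, both evaluated at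
`x`, and let `C x` be the set of simulations of one tree by the other, tagged with the direction.
One of two trees always simulates the other, by the determinacy argument of
`exists_isSimulation_or`, so `C x` is nonempty; being a simulation involves quantifiers over
countable sets only, so the graph is Borel. A Borel choice would select the direction, hence a Borel
set `D`. At the point `x` that codes `D` and its complement, exactly one of the two trees has an
infinite branch, and since simulations preserve infinite branches the selected direction is the
wrong one (`not_hasMeasurableChoice_simulationSet`). A Borel isomorphism carries `C` to `[0,1]`.

The probabilistic part holds for every `C` with nonempty values and Borel graph, and for every Borel
isomorphism `b` of `[0,1]` with the graph. The variables `U k` are the coordinates on `[0,1]^ℕ`. Let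
`κ` be the conditional distribution of `X k` given `S k`, and realize it as the distribution of
`h₀ (s, w)` for uniform `w`. In the joint distribution of `((s, h₀ (s, w)), w)`, the conditional
distribution of `w` given the other two is in turn the image of a uniform variable. Feeding
`(S k, X k)` and the independent `U 0` into this second map yields a uniform `W` independent of
`S k` with `X k = h₀ (S k, W)` almost surely (`exists_map_eq_of_uniform`). The equality is extended
to all sample points by storing the value of `X k` in a null Borel set isomorphic to `[0,1]`
whenever it fails (`exists_functional_representation`).
-/

/-! ### Simulations between relations -/

/-- The relation `E` admits an infinite path starting at `a`. -/
def HasInfinitePath {α : Type*} (E : α → α → Prop) (a : α) : Prop :=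
  ∃ p : ℕ → α, p 0 = a ∧ ∀ n, E (p n) (p (n + 1))

/-- `R` is a simulation of `E` by `F`: whenever `R s t`, every `E`-step from `s` can be answered
by an `F`-step from `t` that leads to a pair related by `R`. -/
def IsSimulation {α β : Type*} (E : α → α → Prop) (F : β → β → Prop) (R : α → β → Prop) : Prop :=
  ∀ s t, R s t → ∀ s', E s s' → ∃ t', F t t' ∧ R s' t'

theorem IsSimulation.hasInfinitePath {α β : Type*} {E : α → α → Prop} {F : β → β → Prop}
    {R : α → β → Prop} (hR : IsSimulation E F R) {a : α} {b : β} (hab : R a b)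
    (h : HasInfinitePath E a) : HasInfinitePath F b := by
  obtain ⟨p, rfl, hp⟩ := h
  choose f hf hfR using fun (n : ℕ) (t : {t // R (p n) t}) => hR (p n) t t.2 (p (n + 1)) (hp n)
  let q : ∀ n, {t // R (p n) t} := fun n =>
    Nat.rec (motive := fun n => {t // R (p n) t}) ⟨b, hab⟩ (fun n t => ⟨f n t, hfR n t⟩) n
  exact ⟨fun n => q n, rfl, fun n => hf n (q n)⟩

/-- Of two rooted relations, one is simulated by the other. If `(a, b)` lies in no simulation of
`E` by `F`, then the negation of the greatest such simulation is a simulation of `F` by `E`: at a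
losing pair `(s, t)` there is a single step `s → s'` that stays losing against every `t → t'`. -/
theorem exists_isSimulation_or {α β : Type*} (E : α → α → Prop) (F : β → β → Prop)
    (a : α) (b : β) :
    (∃ R, IsSimulation E F R ∧ R a b) ∨ ∃ R, IsSimulation F E R ∧ R b a := by
  by_cases h : ∃ R, IsSimulation E F R ∧ R a b
  · exact Or.inl h
  refine Or.inr ⟨fun t s => ¬ ∃ R, IsSimulation E F R ∧ R s t, fun t s hts t' ht' => ?_, h⟩
  by_contra! hcon
  refine hts ⟨fun u v => (∃ R, IsSimulation E F R ∧ R u v) ∨ (u = s ∧ v = t), ?_, Or.inr ⟨rfl, rfl⟩⟩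
  rintro u v (⟨R, hR, huv⟩ | ⟨rfl, rfl⟩) u' hu'
  · obtain ⟨v', hv', hR'⟩ := hR u v huv u' hu'
    exact ⟨v', hv', Or.inl ⟨R, hR, hR'⟩⟩
  · exact ⟨t', ht', Or.inl (hcon u' hu')⟩

/-! ### Coding Borel subsets of the Cantor space by trees -/

/-- The one-step extension relation, at the point `x`, of the tree coded by `z`. A node is a finite
sequence in reverse order, as in `PiNat.res`, and `z (s, k, b)` is read as: some branch through `s`
witnesses a point whose `k`-th digit is `b`. A node of length `n` tests the digits `k < n` only, so
that an infinite branch tests every digit against arbitrarily long initial segments of itself. -/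
def codeEdge (z : List ℕ × ℕ × Bool → Bool) (x : ℕ → Bool) (s s' : List ℕ) : Prop :=
  (∃ n, s' = n :: s) ∧ ∀ k < s'.length, z (s', k, x k) = true

/-- Universality: every Borel set consists of the points at which a suitable coded tree has an
infinite branch. -/
theorem MeasurableSet.exists_code {D : Set (ℕ → Bool)} (hD : MeasurableSet D) :
    ∃ z, ∀ x, x ∈ D ↔ HasInfinitePath (codeEdge z x) [] := by
  classical
  have : PolishSpace (ℕ → Bool) := by constructor
  have hA := hD.analyticSet
  rw [AnalyticSet] at hA
  rcases hA with rfl | ⟨g, hg, rfl⟩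
  · refine ⟨fun _ => false, fun x => ⟨fun h => h.elim, ?_⟩⟩
    rintro ⟨p, h0, hp⟩
    obtain ⟨⟨n, hn⟩, h⟩ := hp 0
    exact absurd (h 0 (by simp [hn])) (by simp)
  · -- `D` is the range of the continuous map `g`; the code records the digits of `g a` that are
    -- possible when an initial segment of `a` is known.
    refine ⟨fun q => decide (∃ a : ℕ → ℕ, PiNat.res a q.1.length = q.1 ∧ g a q.2.1 = q.2.2),
      fun x => ⟨?_, ?_⟩⟩
    · rintro ⟨a, rfl⟩
      refine ⟨PiNat.res a, rfl, fun n => ⟨⟨a n, rfl⟩, fun k _ => ?_⟩⟩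
      simp only [decide_eq_true_eq]
      exact ⟨a, by rw [PiNat.res_length], rfl⟩
    · rintro ⟨p, h0, hp⟩
      choose a ha using fun n => (hp n).1
      have hres : ∀ n, p n = PiNat.res a n := by
        intro n
        induction n with
        | zero => exact h0
        | succ n ih => rw [ha n, ih, PiNat.res_succ]
      refine ⟨a, funext fun k => ?_⟩
      -- By continuity, a long enough prefix of `a` determines the `k`-th digit of `g a`.
      have hopen : IsOpen {c : ℕ → ℕ | g c k = g a k} :=
        (isOpen_discrete {g a k}).preimage ((continuous_apply k).comp hg)
      obtain ⟨t, ⟨c, m, rfl⟩, hat, htsub⟩ :=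
        (PiNat.isTopologicalBasis_cylinders (fun _ => ℕ)).exists_subset_of_mem_open
          (show a ∈ {c : ℕ → ℕ | g c k = g a k} from rfl) hopen
      have hz := (hp (max m k)).2 k (by rw [hres, PiNat.res_length]; omega)
      simp only [decide_eq_true_eq] at hz
      obtain ⟨d, hd, hdk⟩ := hz
      rw [hres, PiNat.res_length, PiNat.res_eq_res] at hd
      rw [← hdk]
      refine (htsub (?_ : d ∈ PiNat.cylinder c m)).symm
      intro i hi
      rw [hd (by omega)]
      exact hat i hi

/-! ### A Borel set without a Borel uniformization -/

/-- A point of the Cantor space carries two codes, indexed by `Bool`. -/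
def codeOf (x : ℕ → Bool) (i : Bool) (q : List ℕ × ℕ × Bool) : Bool :=
  x (Encodable.encode (i, q))

theorem exists_codeOf_eq (z : Bool → List ℕ × ℕ × Bool → Bool) : ∃ x, codeOf x = z :=
  ⟨fun n => (Encodable.decode (α := Bool × List ℕ × ℕ × Bool) n).elim false fun q => z q.1 q.2,
    by ext; simp only [codeOf, Encodable.encodek, Option.elim_some]⟩

/-- The `i`-th of the two trees that `x` codes, evaluated at `x` itself. -/
def diagEdge (x : ℕ → Bool) (i : Bool) : List ℕ → List ℕ → Prop :=
  codeEdge (codeOf x i) x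

/-- The digit of `y` that says which of the two trees simulates the other one. -/
def sideOf (y : ℕ → Bool) : Bool :=
  y (Encodable.encode (none : Option (List ℕ × List ℕ)))

/-- The relation between nodes coded by the remaining digits of `y`. -/
def relOf (y : ℕ → Bool) (s t : List ℕ) : Prop :=
  y (Encodable.encode (some (s, t))) = true

theorem exists_sideOf_relOf_eq (i : Bool) (R : List ℕ → List ℕ → Prop) :
    ∃ y, sideOf y = i ∧ relOf y = R := by
  classical
  refine ⟨fun n => (Encodable.decode (α := Option (List ℕ × List ℕ)) n).elim false
    fun o => o.elim i fun q => decide (R q.1 q.2), ?_, ?_⟩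
  · simp only [sideOf, Encodable.encodek, Option.elim_some, Option.elim_none]
  · ext s t
    simp only [relOf, Encodable.encodek, Option.elim_some, decide_eq_true_eq]

/-- The simulations between the two trees that `x` codes: `y` belongs to this set if its relation
is a simulation of one tree by the other, the latter being the one that `sideOf y` names. -/
def simulationSet (x : ℕ → Bool) : Set (ℕ → Bool) :=
  {y | IsSimulation (diagEdge x (!sideOf y)) (diagEdge x (sideOf y)) (relOf y) ∧ relOf y [] []}

theorem simulationSet_nonempty (x : ℕ → Bool) : (simulationSet x).Nonempty := by
  rcases exists_isSimulation_or (diagEdge x false) (diagEdge x true) [] [] with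
    ⟨R, hR, h⟩ | ⟨R, hR, h⟩
  · obtain ⟨y, hi, rfl⟩ := exists_sideOf_relOf_eq true R
    exact ⟨y, by simpa [hi] using hR, h⟩
  · obtain ⟨y, hi, rfl⟩ := exists_sideOf_relOf_eq false R
    exact ⟨y, by simpa [hi] using hR, h⟩

theorem measurable_apply_comp {Ω : Type*} [MeasurableSpace Ω] {f : Ω → ℕ → Bool}
    {j : Ω → ℕ} (hf : Measurable f) (hj : Measurable j) : Measurable fun ω => f ω (j ω) :=
  (measurable_from_prod_countable_left (f := fun q : (ℕ → Bool) × ℕ => q.1 q.2)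
    fun n => measurable_pi_apply n).comp (hf.prodMk hj)

theorem measurable_diagEdge (i : Bool) (s s' : List ℕ) :
    Measurable fun x => diagEdge x i s s' := by
  refine measurable_const.and (Measurable.forall fun k => measurable_const.imp ?_)
  refine (measurable_apply_comp measurable_id ?_).eq_const true
  exact (measurable_from_top (f := fun b => Encodable.encode (i, s', k, b))).comp
    (measurable_pi_apply k)

theorem measurable_relOf (s t : List ℕ) : Measurable fun y => relOf y s t := by
  have h : Measurable fun y : ℕ → Bool => y (Encodable.encode (some (s, t))) :=
    measurable_pi_apply _
  exact h.eq_const true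

theorem hasMeasurableGraph_simulationSet : HasMeasurableGraph simulationSet := by
  have hside : Measurable fun q : (ℕ → Bool) × (ℕ → Bool) => sideOf q.2 :=
    (measurable_pi_apply _).comp measurable_snd
  have hrel : ∀ s t, Measurable fun q : (ℕ → Bool) × (ℕ → Bool) => relOf q.2 s t := fun s t =>
    (measurable_relOf s t).comp measurable_snd
  have hedge : ∀ i s s', Measurable fun q : (ℕ → Bool) × (ℕ → Bool) => diagEdge q.1 i s s' :=
    fun i s s' => (measurable_diagEdge i s s').comp measurable_fst
  have hsim : ∀ i, Measurable fun q : (ℕ → Bool) × (ℕ → Bool) =>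
      IsSimulation (diagEdge q.1 (!i)) (diagEdge q.1 i) (relOf q.2) := fun i =>
    Measurable.forall fun s => Measurable.forall fun t => (hrel s t).imp <|
      Measurable.forall fun s' => (hedge _ s s').imp <|
        Measurable.exists fun t' => (hedge _ t t').and (hrel s' t')
  have h : Measurable fun q : (ℕ → Bool) × (ℕ → Bool) => ∃ i : Bool, sideOf q.2 = i ∧
      IsSimulation (diagEdge q.1 (!i)) (diagEdge q.1 i) (relOf q.2) ∧ relOf q.2 [] [] :=
    Measurable.exists fun i => (hside.eq_const i).and ((hsim i).and (hrel _ _))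
  rw [HasMeasurableGraph]
  convert! h.setOf using 1
  ext q
  simp only [choiceGraph, simulationSet, Set.mem_ofPred_eq, exists_eq_left']

/-- A Borel choice `ψ` would split the Cantor space into a Borel set `D` and its complement
according to `sideOf (ψ x)`. At the point `x` whose trees code `D` and its complement, the chosen
simulation turns a witness of `x ∈ D` into one of `x ∉ D`, and conversely. -/
theorem not_hasMeasurableChoice_simulationSet : ¬ HasMeasurableChoice simulationSet := by
  rintro ⟨ψ, hψ, hmem⟩
  let D : Set (ℕ → Bool) := {x | sideOf (ψ x) = true}
  have hside : Measurable sideOf := measurable_pi_apply _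
  have hD : MeasurableSet D := measurableSet_eq_fun (hside.comp hψ) measurable_const
  obtain ⟨z₀, hz₀⟩ := hD.exists_code
  obtain ⟨z₁, hz₁⟩ := hD.compl.exists_code
  obtain ⟨x, hx⟩ := exists_codeOf_eq fun i => bif i then z₁ else z₀
  have h₀ : x ∈ D ↔ HasInfinitePath (diagEdge x false) [] := by
    rw [hz₀, diagEdge, hx]; rfl
  have h₁ : x ∈ Dᶜ ↔ HasInfinitePath (diagEdge x true) [] := by
    rw [hz₁, diagEdge, hx]; rfl
  obtain ⟨hsim, hroot⟩ := hmem x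
  by_cases hxD : x ∈ D
  · rw [show sideOf (ψ x) = true from hxD] at hsim
    exact h₁.2 (hsim.hasInfinitePath hroot (h₀.1 hxD)) hxD
  · rw [show sideOf (ψ x) = false from Bool.eq_false_iff.2 hxD] at hsim
    exact hxD (h₀.2 (hsim.hasInfinitePath hroot (h₁.1 hxD)))

theorem not_countable_unitInterval : ¬ Countable I := by
  rw [Set.countable_coe_iff, Cardinal.Real.Icc_countable_iff]
  norm_num

theorem exists_measurableGraph_not_measurableChoice :
    ∃ C : I → Set I, (∀ s, (C s).Nonempty) ∧ HasMeasurableGraph C ∧ ¬ HasMeasurableChoice C := by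
  let e : I ≃ᵐ (ℕ → Bool) :=
    PolishSpace.measurableEquivNatBoolOfNotCountable not_countable_unitInterval
  refine ⟨fun s => e ⁻¹' simulationSet (e s), fun s => ?_, ?_, ?_⟩
  · obtain ⟨y, hy⟩ := simulationSet_nonempty (e s)
    exact ⟨e.symm y, by simpa using hy⟩
  · exact (e.measurable.prodMap e.measurable) hasMeasurableGraph_simulationSet
  · rintro ⟨ψ, hψ, h⟩
    refine not_hasMeasurableChoice_simulationSet
      ⟨e ∘ ψ ∘ e.symm, e.measurable.comp (hψ.comp e.symm.measurable), fun x => ?_⟩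
    simpa using h (e.symm x)

/-! ### Functional representation of a random variable -/

/-- There is a null Borel set `N` into which `[0,1]` embeds by `c`, with Borel left inverse `d`:
under a Borel isomorphism of `[0,1]` with its square, at most countably many of the uncountably
many vertical fibres have positive measure. -/
theorem exists_null_borel_embedding :
    ∃ (N : Set I) (c d : I → I), MeasurableSet N ∧ volume N = 0 ∧ Measurable c ∧ Measurable d ∧
      (∀ x, c x ∈ N) ∧ ∀ x, d (c x) = x := by
  have hII : ¬ Countable (I × I) := fun _ =>
    not_countable_unitInterval (Prod.mk_right_injective (0 : I)).countable
  let φ : I ≃ᵐ I × I :=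
    PolishSpace.measurableEquivOfNotCountable not_countable_unitInterval hII
  have hm : Measurable fun w => (φ w).1 := measurable_fst.comp φ.measurable
  obtain ⟨t, ht⟩ : ∃ t, ¬ 0 < (volume : Measure I) {w | (φ w).1 = t} := by
    by_contra! hcon
    have := Measure.countable_meas_level_set_pos (μ := (volume : Measure I)) hm
    exact not_countable_unitInterval
      (Set.countable_univ_iff.1 (this.mono fun t _ => hcon t))
  exact ⟨{w | (φ w).1 = t}, fun x => φ.symm (t, x), fun w => (φ w).2,
    measurableSet_eq_fun hm measurable_const, le_zero_iff.1 (not_lt.1 ht),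
    φ.symm.measurable.comp measurable_prodMk_left, measurable_snd.comp φ.measurable,
    fun x => by simp, fun x => by simp⟩

theorem map_prod_volume_eq_compProd {α β : Type*} [MeasurableSpace α] [MeasurableSpace β]
    (μ : Measure α) [SFinite μ] (κ : Kernel α β) [IsSFiniteKernel κ] {f : α → I → β}
    (hf : Measurable (Function.uncurry f)) (h : ∀ a, volume.map (f a) = κ a) :
    (μ.prod volume).map (fun q => (q.1, f q.1 q.2)) = μ ⊗ₘ κ := by
  ext s hs
  have hm : Measurable fun q : α × I => (q.1, f q.1 q.2) := measurable_fst.prodMk hf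
  rw [Measure.map_apply hm hs, Measure.prod_apply (hm hs), Measure.compProd_apply hs]
  refine lintegral_congr fun a => ?_
  have hfa : Measurable (f a) := hf.comp measurable_prodMk_left
  rw [← h a, Measure.map_apply hfa (measurable_prodMk_left hs)]
  rfl

/-- Transfer: `X` is, jointly with `S`, distributed as `h (S, ·)` of an independent uniform
variable, and an auxiliary uniform variable `U` suffices to realize that uniform variable, given
`S` and `X`, on the original probability space. Both maps come from representing a conditional
distribution as the image of the uniform distribution. -/
theorem exists_map_eq_of_uniform {Ω α β : Type*} [MeasurableSpace Ω] [MeasurableSpace α]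
    [MeasurableSpace β] [StandardBorelSpace β] [Nonempty β] {P : Measure Ω}
    [IsProbabilityMeasure P] {S : Ω → α} {X : Ω → β} {U : Ω → I} (hS : Measurable S)
    (hX : Measurable X) (hU : IsUniform U P) (hind : IndepFun (fun ω => (S ω, X ω)) U P) :
    ∃ (h : α × I → β) (g : (α × β) × I → I), Measurable h ∧ Measurable g ∧
      P.map (fun ω => ((S ω, X ω), g ((S ω, X ω), U ω))) =
        ((P.map S).prod volume).map (fun q => ((q.1, h q), q.2)) := by
  have hSX : Measurable fun ω => (S ω, X ω) := hS.prodMk hX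
  have : IsProbabilityMeasure (P.map S) := Measure.isProbabilityMeasure_map hS.aemeasurable
  have : IsProbabilityMeasure (P.map fun ω => (S ω, X ω)) :=
    Measure.isProbabilityMeasure_map hSX.aemeasurable
  set μ : Measure (α × β) := P.map fun ω => (S ω, X ω) with hμ
  have hfst : μ.fst = P.map S := Measure.fst_map_prodMk hX
  obtain ⟨h, hh, hhκ⟩ := Kernel.exists_measurable_map_eq_unitInterval μ.condKernel
  have hm : Measurable fun q : α × I => ((q.1, h q.1 q.2), q.2) :=
    (measurable_fst.prodMk hh).prodMk measurable_snd
  set ρ : Measure ((α × β) × I) :=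
    ((P.map S).prod volume).map (fun q => ((q.1, h q.1 q.2), q.2)) with hρ
  have : IsProbabilityMeasure ρ := Measure.isProbabilityMeasure_map hm.aemeasurable
  have hρfst : ρ.fst = μ := by
    rw [hρ, Measure.fst_map_prodMk measurable_snd,
      map_prod_volume_eq_compProd _ μ.condKernel hh hhκ, ← hfst, μ.disintegrate]
  obtain ⟨g, hg, hgη⟩ := Kernel.exists_measurable_map_eq_unitInterval ρ.condKernel
  have hgm : Measurable fun q : (α × β) × I => (q.1, g q.1 q.2) := measurable_fst.prodMk hg
  refine ⟨Function.uncurry h, Function.uncurry g, hh, hg, ?_⟩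
  change _ = ρ
  rw [← ρ.disintegrate ρ.condKernel, hρfst, ← map_prod_volume_eq_compProd μ _ hg hgη, hμ,
    ← hU.2, ← hind.map_prod_eq_prod_map_map hSX.aemeasurable hU.1.aemeasurable,
    Measure.map_map hgm (hSX.prodMk hU.1)]
  rfl

/-- Functional representation: `X` is, at every point of the sample space, a fixed Borel function
of `S` and of a uniform variable `W` that is independent of `S` and is computed from `S`, `X` and
an auxiliary uniform variable `U`. -/
theorem exists_functional_representation {Ω : Type*} [MeasurableSpace Ω] {P : Measure Ω}
    [IsProbabilityMeasure P] {S X U : Ω → I} (hS : Measurable S) (hX : Measurable X)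
    (hU : IsUniform U P) (hind : IndepFun (fun ω => (S ω, X ω)) U P) :
    ∃ (h : I × I → I) (W : Ω → I), Measurable h ∧ IsUniform W P ∧ IndepFun W S P ∧
      Measurable[MeasurableSpace.comap (fun ω => (S ω, X ω, U ω)) inferInstance] W ∧
      ∀ ω, X ω = h (S ω, W ω) := by
  classical
  obtain ⟨h₀, g, hh₀, hg, hlaw⟩ := exists_map_eq_of_uniform hS hX hU hind
  obtain ⟨N, c, d, hN, hN0, hc, hd, hcN, hdc⟩ := exists_null_borel_embedding
  have : IsProbabilityMeasure (P.map S) := Measure.isProbabilityMeasure_map hS.aemeasurable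
  set W₀ : Ω → I := fun ω => g ((S ω, X ω), U ω) with hW₀
  have hW₀m : Measurable W₀ := hg.comp ((hS.prodMk hX).prodMk hU.1)
  have hYm : Measurable fun ω => ((S ω, X ω), W₀ ω) := (hS.prodMk hX).prodMk hW₀m
  have hrm : Measurable fun q : I × I => ((q.1, h₀ q), q.2) :=
    (measurable_fst.prodMk hh₀).prodMk measurable_snd
  have hSW₀ : P.map (fun ω => (S ω, W₀ ω)) = (P.map S).prod volume := by
    have hp : Measurable fun p : (I × I) × I => (p.1.1, p.2) := by fun_prop
    have := congrArg (Measure.map fun p : (I × I) × I => (p.1.1, p.2)) hlaw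
    rw [Measure.map_map hp hYm, Measure.map_map hp hrm] at this
    exact this.trans Measure.map_id
  have hW₀u : P.map W₀ = volume := by
    have := congrArg Measure.snd hSW₀
    rwa [Measure.snd_map_prodMk hS, Measure.snd_prod] at this
  have hW₀i : IndepFun W₀ S P := by
    refine IndepFun.symm ?_
    rw [indepFun_iff_map_prod_eq_prod_map_map hS.aemeasurable hW₀m.aemeasurable, hSW₀, hW₀u]
  -- On the exceptional null set, `W` is moved into `N`, where `h` reads the value of `X` off it.
  let bad : Set (I × I × I) :=
    {q | h₀ (q.1, g ((q.1, q.2.1), q.2.2)) ≠ q.2.1 ∨ g ((q.1, q.2.1), q.2.2) ∈ N}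
  have hgm : Measurable fun q : I × I × I => g ((q.1, q.2.1), q.2.2) := hg.comp (by fun_prop)
  have hbad : MeasurableSet bad :=
    (measurableSet_eq_fun (hh₀.comp (measurable_fst.prodMk hgm))
      (measurable_fst.comp measurable_snd)).compl.union (hgm hN)
  let w : I × I × I → I := bad.piecewise (fun q => c q.2.1) (fun q => g ((q.1, q.2.1), q.2.2))
  have hw : Measurable w := Measurable.piecewise hbad (by fun_prop) hgm
  have hw_mem {ω} (hb : (S ω, X ω, U ω) ∈ bad) : w (S ω, X ω, U ω) = c (X ω) :=
    Set.piecewise_eq_of_mem bad _ (fun q => g ((q.1, q.2.1), q.2.2)) hb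
  have hw_notMem {ω} (hb : (S ω, X ω, U ω) ∉ bad) : w (S ω, X ω, U ω) = W₀ ω :=
    Set.piecewise_eq_of_notMem bad (fun q => c q.2.1) _ hb
  have hae : W₀ =ᵐ[P] fun ω => w (S ω, X ω, U ω) := by
    have h1 : ∀ᵐ ω ∂P, h₀ (S ω, W₀ ω) = X ω := by
      have hE : MeasurableSet {p : (I × I) × I | h₀ (p.1.1, p.2) = p.1.2} :=
        measurableSet_eq_fun (hh₀.comp (by fun_prop)) (by fun_prop)
      have : ∀ᵐ p ∂P.map (fun ω => ((S ω, X ω), W₀ ω)), h₀ (p.1.1, p.2) = p.1.2 := by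
        rw [hlaw, ae_map_iff hrm.aemeasurable hE]
        exact ae_of_all _ fun q => rfl
      exact (ae_map_iff hYm.aemeasurable hE).1 this
    have h2 : ∀ᵐ ω ∂P, W₀ ω ∉ N := by
      refine (ae_map_iff hW₀m.aemeasurable hN.compl).1 ?_
      rw [hW₀u]
      exact measure_eq_zero_iff_ae_notMem.1 hN0
    filter_upwards [h1, h2] with ω hω1 hω2
    exact (hw_notMem (not_or.2 ⟨not_not.2 hω1, hω2⟩)).symm
  refine ⟨fun q => if q.2 ∈ N then d q.2 else h₀ q,
    fun ω => w (S ω, X ω, U ω), ?_, ⟨?_, ?_⟩, ?_, ?_, fun ω => ?_⟩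
  · exact Measurable.ite (measurable_snd hN) (hd.comp measurable_snd) hh₀
  · exact hw.comp (hS.prodMk (hX.prodMk hU.1))
  · rw [← Measure.map_congr hae, hW₀u]
  · exact hW₀i.congr hae (Filter.EventuallyEq.refl _ _)
  · exact hw.comp (comap_measurable _)
  · by_cases hb : (S ω, X ω, U ω) ∈ bad
    · simp only [hw_mem hb, hcN, if_true, hdc]
    · have hb' := not_or.1 hb
      simp only [hw_notMem hb]
      rw [if_neg hb'.2]
      exact (not_not.1 hb'.1).symm

/-! ### Random selections from the graph -/

theorem not_countable_choiceGraph {C : I → Set I} (hne : ∀ s, (C s).Nonempty) :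
    ¬ Countable (choiceGraph C) := fun _ => by
  have hsurj : Function.Surjective fun p : choiceGraph C => p.1.1 := fun s =>
    ⟨⟨(s, (hne s).some), (hne s).some_mem⟩, rfl⟩
  exact not_countable_unitInterval hsurj.countable

theorem isIID_eval_infinitePi {ι E : Type*} [MeasurableSpace E] (μ : Measure E)
    [IsProbabilityMeasure μ] :
    IsIID (fun (i : ι) (ω : ι → E) => ω i) (Measure.infinitePi fun _ => μ) :=
  ⟨fun i => measurable_pi_apply i,
    iIndepFun_infinitePi (X := fun (_ : ι) (x : E) => x) fun _ => measurable_id,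
    fun i j => ⟨(measurable_pi_apply i).aemeasurable, (measurable_pi_apply j).aemeasurable, by
      rw [Measure.infinitePi_map_eval, Measure.infinitePi_map_eval]⟩⟩

theorem IsIID.comp_precomp {ι κ Ω E F : Type*} [MeasurableSpace Ω] [MeasurableSpace E]
    [MeasurableSpace F] {Y : ι → Ω → E} {P : Measure Ω} (hY : IsIID Y P) {f : E → F}
    (hf : Measurable f) {r : κ → ι} (hr : r.Injective) :
    IsIID (fun k ω => f (Y (r k) ω)) P :=
  ⟨fun _ => hf.comp (hY.1 _), (hY.2.1.precomp hr).comp (fun _ => f) fun _ => hf,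
    fun _ _ => (hY.2.2 _ _).comp hf⟩

theorem mainTheorem9 :
    ∃ C : I → Set I,
      (∀ s, (C s).Nonempty) ∧ HasMeasurableGraph C ∧ ¬ HasMeasurableChoice C ∧
      ∃ (b : I ≃ᵐ choiceGraph C)
        (Ω : Type) (_ : MeasurableSpace Ω) (P : Measure Ω) (_ : IsProbabilityMeasure P)
        (U : ℕ → Ω → I) (S X : ℕ+ → Ω → I),
        IsIID U P ∧ (∀ k, IsUniform (U k) P) ∧
        (∀ (k : ℕ+) (ω : Ω), (S k ω, X k ω) = (b (U k ω) : I × I)) ∧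
        IsIID (fun (k : ℕ+) (ω : Ω) => (S k ω, X k ω)) P ∧
        (∀ (k : ℕ+) (ω : Ω), X k ω ∈ C (S k ω)) ∧
        ∀ k : ℕ+, ∃ (h : I × I → I) (W : Ω → I),
          Measurable h ∧ IsUniform W P ∧ IndepFun W (S k) P ∧
          Measurable[MeasurableSpace.comap (fun ω => (S k ω, X k ω, U 0 ω)) inferInstance] W ∧
          (∀ ω, X k ω = h (S k ω, W ω)) ∧
          ∀ (Ω' : Type u) [MeasurableSpace Ω'] (P' : Measure Ω') [IsProbabilityMeasure P']
            (S' W' : Ω' → I), Measurable S' → Measurable W' →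
            IdentDistrib (fun ω' => (S' ω', W' ω')) (fun ω => (S k ω, W ω)) P' P →
            P' {ω' | h (S' ω', W' ω') ∈ C (S' ω')} = 1 := by
  obtain ⟨C, hne, hgraph, hchoice⟩ := exists_measurableGraph_not_measurableChoice
  have : StandardBorelSpace (choiceGraph C) := MeasurableSet.standardBorel hgraph
  let b : I ≃ᵐ choiceGraph C := PolishSpace.measurableEquivOfNotCountable
    not_countable_unitInterval (not_countable_choiceGraph hne)
  have hb : Measurable fun u => (b u : I × I) := measurable_subtype_coe.comp b.measurable
  let P : Measure (ℕ → I) := Measure.infinitePi fun _ => volume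
  have hU : IsIID (fun (k : ℕ) (ω : ℕ → I) => ω k) P := isIID_eval_infinitePi volume
  have hUu : ∀ k, IsUniform (fun ω : ℕ → I => ω k) P := fun k =>
    ⟨measurable_pi_apply k, Measure.infinitePi_map_eval _ k⟩
  let S : ℕ+ → (ℕ → I) → I := fun k ω => (b (ω k) : I × I).1
  let X : ℕ+ → (ℕ → I) → I := fun k ω => (b (ω k) : I × I).2
  have hS : ∀ k, Measurable (S k) := fun k =>
    measurable_fst.comp (hb.comp (measurable_pi_apply (k : ℕ)))
  have hX : ∀ k, Measurable (X k) := fun k =>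
    measurable_snd.comp (hb.comp (measurable_pi_apply (k : ℕ)))
  have hmem : ∀ k ω, X k ω ∈ C (S k ω) := fun k ω => (b (ω k)).2
  refine ⟨C, hne, hgraph, hchoice, b, ℕ → I, inferInstance, P, inferInstance, fun k ω => ω k, S, X,
    hU, hUu, fun _ _ => rfl, hU.comp_precomp hb PNat.coe_injective, hmem, fun k => ?_⟩
  have hind : IndepFun (fun ω => (S k ω, X k ω)) (fun ω : ℕ → I => ω 0) P :=
    (hU.2.1.indepFun k.ne_zero).comp hb measurable_id
  obtain ⟨h, W, hh, hWu, hWi, hWm, hXh⟩ :=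
    exists_functional_representation (hS k) (hX k) (hUu 0) hind
  refine ⟨h, W, hh, hWu, hWi, hWm, hXh, fun Ω' _ P' _ S' W' _ _ hid => ?_⟩
  have hB : MeasurableSet {q : I × I | (q.1, h q) ∈ choiceGraph C} :=
    (measurable_fst.prodMk hh) hgraph
  have hB1 : (fun ω => (S k ω, W ω)) ⁻¹' {q : I × I | (q.1, h q) ∈ choiceGraph C} = Set.univ :=
    Set.eq_univ_of_forall fun ω => by
      change h (S k ω, W ω) ∈ C (S k ω)
      rw [← hXh]
      exact hmem k ω
  exact (hid.measure_mem_eq hB).trans (by rw [hB1, measure_univ])
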